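/- Let $n_T\ge 2$, $\mathbf h\in\mathbb C^{n_T}$, $P_T\in\mathbb R$, and let $\mathbf g=(g_1,\dots,g_{n_T})\sim CN(0,\mathbf I_{n_T})$ (independent circularly symmetric complex Gaussian entries of variance one), $\tilde G_i=|g_i|^2$. Consider the power allocation problem of maximizing $$\left(\log\Big(1+\frac{\|\mathbf h\|^2P_U}{1+\|\mathbf h\|^2P_{V_1}}\Big)-\mathbf E\Big[\log\Big(1+\frac{\tilde G_1P_U}{1+\tilde G_1P_{V_1}+\big(\sum_{i=2}^{n_T}\tilde G_i\big)P_{V_2}}\Big)\Big]\right)^+$$ over $P_U,P_{V_1},P_{V_2}\ge0$ with $P_U+P_{V_1}+(n_T-1)P_{V_2}=P_T$. (Here $P_U$ is the power of the signal; $P_{V_1}$ and $P_{V_2}$ are the powers of the artificial noise (AN) in the direction of $\mathbf h$ and in each direction orthogonal to it; the AN covariance has eigenvalues $P_{V_1},P_{V_2},\dots,P_{V_2}$.) For $k\ge1$ and $x>0$ put $$F_k(x)=\int_0^\infty\frac{xe^{-t}}{(1+xt)^k}\,dt=e^{1/x}E_k(1/x),\qquad E_k(z)=\int_1^\infty\frac{e^{-zu}}{u^k}\,du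 .$$ **Theorem.** Let $(P_U,P_{V_1},P_{V_2})$ be an optimal allocation with $P_{V_1}>0$ and $P_{V_2}>0$ (so that the AN covariance has full rank), and assume $P_{V_2}\ne P_{V_1}$ and $P_{V_2}\neq P_U+P_{V_1}$. For $x\in\{P_{V_1},\,P_U+P_{V_1}\}$ and $y=P_{V_2}$ put $$A_1(x)=\frac{1-n_T}{(1-\frac yx)^{n_T}}\,\frac yx,\quad A_2(x)=\frac1{(1-\frac yx)^{n_T-1}},\quad B_k(x)=\frac{(n_T-k)\left(-\frac xy\right)^{n_T-1-k}}{(1-\frac xy)^{n_T-k+1}}\ (1\le k\le n_T-1),$$ $$A_3(x)=\frac1{(1-\frac yx)^{n_T}},\qquad C_k(x)=\frac{\left(-\frac xy\right)^{n_T-k}}{(1-\frac xy)^{n_T-k+1}}\ (1\le k\le n_T),$$ and write $A_j=A_j(P_{V_1})$, $A_j'=A_j(P_U+P_{V_1})$, and likewise $B_k,B_k',C_k,C_k'$. Let $$\begin{aligned}L_1={}&\frac1{1+\|\mathbf h\|^2P_{V_1}}-\frac{1+\|\mathbf h\|^2P_U}{1+\|\mathbf h\|^2(P_U+P_{V_1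})}+\Big(A_1+(n_T-1)\frac{P_{V_2}}{P_{V_1}}A_3\Big)F_1(P_{V_1})+A_2F_2(P_{V_1})\\&+\frac{P_{V_1}}{P_{V_2}}\sum_{k=1}^{n_T-1}B_kF_k(P_{V_2})+(n_T-1)\sum_{k=1}^{n_T}C_kF_k(P_{V_2})\\&-\frac{P_{V_1}A_1'+(n_T-1)P_{V_2}A_3'}{P_U+P_{V_1}}F_1(P_U+P_{V_1})-\frac{P_{V_1}A_2'}{P_U+P_{V_1}}F_2(P_U+P_{V_1})\\&-\frac{P_{V_1}}{P_{V_2}}\sum_{k=1}^{n_T-1}B_k'F_k(P_{V_2})-(n_T-1)\sum_{k=1}^{n_T}C_k'F_k(P_{V_2}),\end{aligned}$$ $$\begin{aligned}L_2={}&\frac{A_1}{P_{V_1}}F_1(P_{V_1})+\frac{A_2}{P_{V_1}}F_2(P_{V_1})+\sum_{k=1}^{n_T-1}\frac{B_k}{P_{V_2}}F_k(P_{V_2})\\&-\frac{A_1'}{P_U+P_{V_1}}F_1(P_U+P_{V_1})-\frac{A_2'}{P_U+P_{V_1}}F_2(P_U+P_{V_1})-\sum_{k=1}^{n_T-1}\frac{B_k'}{P_{V_2}}F_k(P_{V_2}),\end{aligned}$$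 $$r=\frac{\|\mathbf h\|^4P_U}{(1+\|\mathbf h\|^2P_{V_1})(1+\|\mathbf h\|^2(P_U+P_{V_1}))}.$$ Then $L_1>0$ implies $L_2>r$, and $L_1<0$ implies $L_2<r$. Moreover, with $\mathbf D_1=\mathrm{diag}(P_U+P_{V_1},P_{V_2},\dots,P_{V_2})$, $\mathbf D_2=\mathrm{diag}(P_{V_1},P_{V_2},\dots,P_{V_2})$ and $$\mathbf Y=\mathbf E\left[\frac{\mathbf g\mathbf g^H}{1+\mathbf g^H\mathbf D_2\mathbf g}\right]-\mathbf E\left[\frac{\mathbf g\mathbf g^H}{1+\mathbf g^H\mathbf D_1\mathbf g}\right],$$ one has $L_2=\mathbf Y_{1,1}$ and $L_1=\mathrm{tr}(\mathbf Y\mathbf D_2)-P_{V_1}\,r$. -/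

import Mathlib

open MeasureTheory ProbabilityTheory

noncomputable section

namespace Wiretap

/-- The law `CN(0, 1)` of a circularly symmetric complex Gaussian variable of variance one:
real and imaginary part are independent and `N(0, 1/2)`-distributed. -/
def complexNormal : Measure ℂ :=
  ((gaussianReal 0 (1 / 2)).prod (gaussianReal 0 (1 / 2))).map Complex.measurableEquivRealProd.symm

/-- The law `CN(0, I_n)` of the channel vector `g` of the eavesdropper. -/
def channelLaw (n : ℕ) : Measure (Fin n → ℂ) := Measure.pi fun _ => complexNormal

/-- The difference of ergodic rates for the powers `PU` (signal), `PV1` (artificial noise in the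
direction `h` of the main channel) and `PV2` (artificial noise in each of the `n - 1` directions
orthogonal to `h`).  The index `0` is the direction of the main channel. -/
def rateDiff {n : ℕ} [NeZero n] (h : EuclideanSpace ℂ (Fin n)) (PU PV1 PV2 : ℝ) : ℝ :=
  Real.log (1 + ‖h‖ ^ 2 * PU / (1 + ‖h‖ ^ 2 * PV1)) -
    ∫ g, Real.log (1 + ‖g 0‖ ^ 2 * PU /
      (1 + ‖g 0‖ ^ 2 * PV1 + (∑ i ∈ Finset.univ.erase (0 : Fin n), ‖g i‖ ^ 2) * PV2))
      ∂(channelLaw n)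

/-- The ergodic secrecy rate, the positive part of `rateDiff`. -/
def secrecyRate {n : ℕ} [NeZero n] (h : EuclideanSpace ℂ (Fin n)) (PU PV1 PV2 : ℝ) : ℝ :=
  max 0 (rateDiff h PU PV1 PV2)

/-- Nonnegative powers which use up the total power `PT`. -/
def Feasible (n : ℕ) (PT PU PV1 PV2 : ℝ) : Prop :=
  0 ≤ PU ∧ 0 ≤ PV1 ∧ 0 ≤ PV2 ∧ PU + PV1 + ((n : ℝ) - 1) * PV2 = PT

/-- `(PU, PV1, PV2)` solves the power allocation problem. -/
def IsOptimal {n : ℕ} [NeZero n] (h : EuclideanSpace ℂ (Fin n)) (PT PU PV1 PV2 : ℝ) : Prop :=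
  Feasible n PT PU PV1 PV2 ∧
    ∀ QU QV1 QV2 : ℝ, Feasible n PT QU QV1 QV2 →
      secrecyRate h QU QV1 QV2 ≤ secrecyRate h PU PV1 PV2

/-- The diagonal `(x, y, ..., y)`. -/
def diagEntries (n : ℕ) [NeZero n] (x y : ℝ) (i : Fin n) : ℝ := if i = 0 then x else y

/-- The matrix `E[g gᴴ / (1 + gᴴ D g)]` for `D = diag (d 0, ..., d (n - 1))`. -/
def expectedOuter {n : ℕ} (d : Fin n → ℝ) : Matrix (Fin n) (Fin n) ℂ :=
  Matrix.of fun i j =>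
    ∫ g, g i * (starRingEnd ℂ) (g j) / ((1 + ∑ l, d l * ‖g l‖ ^ 2 : ℝ) : ℂ) ∂(channelLaw n)

/-- The matrix `Y = E[g gᴴ / (1 + gᴴ D₂ g)] - E[g gᴴ / (1 + gᴴ D₁ g)]` with
`D₂ = diag (PV1, PV2, ..., PV2)` and `D₁ = diag (PU + PV1, PV2, ..., PV2)`. -/
def matrixY (n : ℕ) [NeZero n] (PU PV1 PV2 : ℝ) : Matrix (Fin n) (Fin n) ℂ :=
  expectedOuter (diagEntries n PV1 PV2) - expectedOuter (diagEntries n (PU + PV1) PV2)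

/-- The exponential integral `E_k`. -/
def expIntegralE (k : ℕ) (z : ℝ) : ℝ := ∫ u in Set.Ioi (1 : ℝ), Real.exp (-(z * u)) / u ^ k

/-- `F_k(x) = ∫_0^∞ x e^{-t} / (1 + x t)^k dt`. -/
def F (k : ℕ) (x : ℝ) : ℝ := ∫ t in Set.Ioi (0 : ℝ), x * Real.exp (-t) / (1 + x * t) ^ k

theorem F_eq_exp_mul_expIntegralE (k : ℕ) {x : ℝ} (hx : 0 < x) :
    F k x = Real.exp (1 / x) * expIntegralE k (1 / x) := by
  have h1 := integral_comp_mul_left_Ioi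
    (fun u : ℝ => Real.exp (-u / x) / (1 + u) ^ k) 0 hx
  have h2 : ∫ u in Set.Ioi (0 : ℝ), Real.exp (-u / x) / (1 + u) ^ k
      = ∫ u in Set.Ioi (1 : ℝ), Real.exp (-(u - 1) / x) / u ^ k := by
    have := (measurePreserving_add_left (volume : Measure ℝ) 1).setIntegral_preimage_emb
      (MeasurableEquiv.addLeft (1 : ℝ)).measurableEmbedding
      (fun u : ℝ => Real.exp (-(u - 1) / x) / u ^ k) (Set.Ioi 1)
    rw [← this]
    simp
  have h3 : F k x = x * ∫ t in Set.Ioi (0 : ℝ), Real.exp (-(x * t) / x) / (1 + x * t) ^ k := by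
    rw [F, ← integral_const_mul]
    refine integral_congr_ae (Filter.Eventually.of_forall fun t => ?_)
    have : -(x * t) / x = -t := by field_simp
    simp only [this, mul_div_assoc]
  rw [h3, h1, mul_zero, h2, smul_eq_mul, ← mul_assoc, mul_inv_cancel₀ hx.ne', one_mul,
    expIntegralE, ← integral_const_mul]
  refine integral_congr_ae (Filter.Eventually.of_forall fun u => ?_)
  have : -(u - 1) / x = 1 / x + -(1 / x * u) := by field_simp; ring
  simp only [this, Real.exp_add, mul_div_assoc]

/-! Coefficients of the partial fraction expansions, for `x ≠ y`,
`1 / ((1 + x t)^2 (1 + y t)^(n-1))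
  = A1 / (1 + x t) + A2 / (1 + x t)^2 + ∑ k ∈ [1, n-1], B k / (1 + y t)^k` and
`1 / ((1 + x t) (1 + y t)^n) = A3 / (1 + x t) + ∑ k ∈ [1, n], C k / (1 + y t)^k`. -/

def A1 (n : ℕ) (x y : ℝ) : ℝ := (1 - (n : ℝ)) / (1 - y / x) ^ n * (y / x)

def A2 (n : ℕ) (x y : ℝ) : ℝ := 1 / (1 - y / x) ^ (n - 1)

def B (n : ℕ) (x y : ℝ) (k : ℕ) : ℝ :=
  ((n : ℝ) - (k : ℝ)) * (-(x / y)) ^ (n - 1 - k) / (1 - x / y) ^ (n - k + 1)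

def A3 (n : ℕ) (x y : ℝ) : ℝ := 1 / (1 - y / x) ^ n

def C (n : ℕ) (x y : ℝ) (k : ℕ) : ℝ := (-(x / y)) ^ (n - k) / (1 - x / y) ^ (n - k + 1)

/-- The left-hand side of the first inequality, with `η = ‖h‖²`. -/
def firstLHS (n : ℕ) (η PU PV1 PV2 : ℝ) : ℝ :=
  1 / (1 + η * PV1) - (1 + η * PU) / (1 + η * (PU + PV1))
    + (A1 n PV1 PV2 + ((n : ℝ) - 1) * (PV2 / PV1) * A3 n PV1 PV2) * F 1 PV1
    + A2 n PV1 PV2 * F 2 PV1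
    + PV1 / PV2 * ∑ k ∈ Finset.Icc 1 (n - 1), B n PV1 PV2 k * F k PV2
    + ((n : ℝ) - 1) * ∑ k ∈ Finset.Icc 1 n, C n PV1 PV2 k * F k PV2
    - (PV1 * A1 n (PU + PV1) PV2 + ((n : ℝ) - 1) * PV2 * A3 n (PU + PV1) PV2) / (PU + PV1)
        * F 1 (PU + PV1)
    - PV1 * A2 n (PU + PV1) PV2 / (PU + PV1) * F 2 (PU + PV1)
    - PV1 / PV2 * ∑ k ∈ Finset.Icc 1 (n - 1), B n (PU + PV1) PV2 k * F k PV2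
    - ((n : ℝ) - 1) * ∑ k ∈ Finset.Icc 1 n, C n (PU + PV1) PV2 k * F k PV2

/-- The left-hand side of the second inequality. -/
def secondLHS (n : ℕ) (PU PV1 PV2 : ℝ) : ℝ :=
  (A1 n PV1 PV2 / PV1 * F 1 PV1 + A2 n PV1 PV2 / PV1 * F 2 PV1)
    + ∑ k ∈ Finset.Icc 1 (n - 1), B n PV1 PV2 k / PV2 * F k PV2
    - A1 n (PU + PV1) PV2 / (PU + PV1) * F 1 (PU + PV1)
    - A2 n (PU + PV1) PV2 / (PU + PV1) * F 2 (PU + PV1)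
    - ∑ k ∈ Finset.Icc 1 (n - 1), B n (PU + PV1) PV2 k / PV2 * F k PV2

/-- The right-hand side of the second inequality, with `η = ‖h‖²`. -/
def secondRHS (η PU PV1 : ℝ) : ℝ :=
  η ^ 2 * PU / ((1 + η * PV1) * (1 + η * (PU + PV1)))

end Wiretap

end

/-! ### Gaussian moments of the channel vector -/

namespace Wiretap

/-! Write `1 / q = ∫ e^{-tq} dt` in the diagonal entries of `expectedOuter`; by independence of the
`g l` they become integrals of `e^{-t}` times a rational function of `t`, and partial fractions turn
these into combinations of the `F k`. This identifies `L₂` with `Y₁₁` and gives `L₁ = PV1 (L₂ - r) +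
PV2 J`, where `J` is the trace of `Y` over the orthogonal directions. Since `J ≥ 0`, `L₁ < 0` forces
`L₂ < r` without using optimality.

For the other implication, `PU = 0` gives `L₁ = 0`, while for `PU > 0` optimality alone yields `L₂ >
r` (`secondRHS_lt_of_isOptimal`). If the optimal rate is positive, the positive part is inactive,
and stationarity under a transfer of noise power from `h` to the orthogonal directions reads `L₂ - r
= J / (n - 1)`, with `J > 0`. If it is zero, every feasible rate difference is nonpositive; testing
this with small signal powers bounds the two expectations in `Y₁₁` from below, and a pointwise
correlation inequality gives `L₂ > r` (`lt_integral_sub_integral_of_gainRate_nonpos`). -/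

instance isProbabilityMeasure_complexNormal : IsProbabilityMeasure complexNormal :=
  Measure.isProbabilityMeasure_map (MeasurableEquiv.measurable _).aemeasurable

instance isProbabilityMeasure_channelLaw (n : ℕ) : IsProbabilityMeasure (channelLaw n) := by
  unfold channelLaw; infer_instance

instance nullSingletonClass_complexNormal : NullSingletonClass complexNormal := by
  have : NullSingletonClass (gaussianReal 0 (1 / 2)) := nullSingletonClass_gaussianReal (by simp)
  refine ⟨fun z => ?_⟩
  rw [complexNormal, MeasurableEquiv.map_apply,
    ← MeasurableEquiv.image_eq_preimage_symm, Set.image_singleton]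
  exact measure_singleton _

/-- Variance `1/2` in each real coordinate makes the product density `π⁻¹ e^{-|z|²}`. -/
theorem integral_complexNormal (f : ℂ → ℝ) :
    ∫ z, f z ∂complexNormal = ∫ z, Real.pi⁻¹ * Real.exp (-‖z‖ ^ 2) * f z := by
  have hv : (1 / 2 : NNReal) ≠ 0 := by simp
  rw [complexNormal, integral_map_equiv, gaussianReal_of_var_ne_zero _ hv,
    prod_withDensity (measurable_gaussianPDF _ _) (measurable_gaussianPDF _ _),
    integral_withDensity_eq_integral_toReal_smul (by fun_prop)
      (Filter.Eventually.of_forall fun p => ENNReal.mul_lt_top (by simp [gaussianPDF])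
        (by simp [gaussianPDF])),
    ← (Complex.volume_preserving_equiv_real_prod.symm).integral_comp
      Complex.measurableEquivRealProd.symm.measurableEmbedding]
  refine integral_congr_ae (Filter.Eventually.of_forall fun p => ?_)
  have h1 : Complex.measurableEquivRealProd.symm p = ⟨p.1, p.2⟩ := rfl
  have h2 : ‖(⟨p.1, p.2⟩ : ℂ)‖ ^ 2 = p.1 ^ 2 + p.2 ^ 2 := by
    rw [Complex.sq_norm, Complex.normSq_mk]; ring
  have h3 : Real.sqrt Real.pi * Real.sqrt Real.pi = Real.pi := Real.mul_self_sqrt Real.pi_pos.le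
  simp only [h1, h2, gaussianPDF, ENNReal.toReal_mul, smul_eq_mul,
    ENNReal.toReal_ofReal (gaussianPDFReal_nonneg _ _ _)]
  simp only [gaussianPDFReal]
  congr 1
  have h4 : (2 * Real.pi * ((1 / 2 : NNReal) : ℝ)) = Real.pi := by push_cast; ring
  have h5 : (2 * ((1 / 2 : NNReal) : ℝ)) = 1 := by push_cast; ring
  rw [h4, h5, neg_add, Real.exp_add, ← h3, mul_inv, h3]
  ring_nf

theorem integral_exp_neg_mul_sq_complexNormal {c : ℝ} (hc : 0 ≤ c) :
    ∫ z, Real.exp (-c * ‖z‖ ^ 2) ∂complexNormal = 1 / (1 + c) := by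
  have h := Complex.integral_rpow_mul_exp_neg_mul_rpow (p := 2) (q := 0) (b := 1 + c)
    (by norm_num) (by norm_num) (by positivity)
  rw [integral_complexNormal]
  simp only [Real.rpow_zero, one_mul, Real.rpow_two] at h
  have : ∀ z : ℂ, Real.pi⁻¹ * Real.exp (-‖z‖ ^ 2) * Real.exp (-c * ‖z‖ ^ 2)
      = Real.pi⁻¹ * Real.exp (-(1 + c) * ‖z‖ ^ 2) := fun z => by
    rw [mul_assoc, ← Real.exp_add]; ring_nf
  simp only [this]
  rw [integral_const_mul, h]
  norm_num [Real.rpow_neg_one]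

theorem integral_sq_mul_exp_neg_mul_sq_complexNormal {c : ℝ} (hc : 0 ≤ c) :
    ∫ z, ‖z‖ ^ 2 * Real.exp (-c * ‖z‖ ^ 2) ∂complexNormal = 1 / (1 + c) ^ 2 := by
  have h := Complex.integral_rpow_mul_exp_neg_mul_rpow (p := 2) (q := 2) (b := 1 + c)
    (by norm_num) (by norm_num) (by positivity)
  rw [integral_complexNormal]
  simp only [Real.rpow_two] at h
  have : ∀ z : ℂ, Real.pi⁻¹ * Real.exp (-‖z‖ ^ 2) * (‖z‖ ^ 2 * Real.exp (-c * ‖z‖ ^ 2))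
      = Real.pi⁻¹ * (‖z‖ ^ 2 * Real.exp (-(1 + c) * ‖z‖ ^ 2)) := fun z => by
    rw [show -(1 + c) * ‖z‖ ^ 2 = -‖z‖ ^ 2 + -c * ‖z‖ ^ 2 by ring, Real.exp_add]; ring
  simp only [this]
  rw [integral_const_mul, h]
  norm_num [Real.Gamma_two]

theorem integrable_sq_complexNormal : Integrable (fun z : ℂ => ‖z‖ ^ 2) complexNormal := by
  by_contra hf
  have h := integral_sq_mul_exp_neg_mul_sq_complexNormal le_rfl
  simp only [neg_zero, zero_mul, Real.exp_zero, mul_one] at h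
  -- A non-integrable function has integral `0`, but the formula with `c = 0` gives `1`.
  rw [integral_undef hf] at h
  norm_num at h

theorem integrable_sq_channelLaw {n : ℕ} (j : Fin n) :
    Integrable (fun g : Fin n → ℂ => ‖g j‖ ^ 2) (channelLaw n) :=
  integrable_comp_eval (μ := fun _ : Fin n => complexNormal) (i := j)
    (f := fun z : ℂ => ‖z‖ ^ 2) integrable_sq_complexNormal

theorem ae_sq_pos_channelLaw {n : ℕ} (j : Fin n) : ∀ᵐ g ∂channelLaw n, 0 < ‖g j‖ ^ 2 := by
  filter_upwards [Measure.ae_eval_ne (μ := fun _ : Fin n => complexNormal) j 0] with g hg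
  have := norm_pos_iff.2 hg
  positivity

/-- By independence the integral factors; the weight `‖g j‖ ^ 2` contributes one extra factor at
`j`. -/
theorem integral_sq_mul_exp_channelLaw {n : ℕ} (c : Fin n → ℝ) (hc : ∀ i, 0 ≤ c i) (j : Fin n) :
    ∫ g, ‖g j‖ ^ 2 * Real.exp (-∑ l, c l * ‖g l‖ ^ 2) ∂channelLaw n
      = 1 / (1 + c j) * ∏ l, 1 / (1 + c l) := by
  have h := integral_fintype_prod_eq_prod (𝕜 := ℝ) (μ := fun _ : Fin n => complexNormal)
    (fun i (z : ℂ) => (if i = j then ‖z‖ ^ 2 else 1) * Real.exp (-c i * ‖z‖ ^ 2))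
  have h1 : ∀ i, ∫ z, (if i = j then ‖z‖ ^ 2 else 1) * Real.exp (-c i * ‖z‖ ^ 2) ∂complexNormal
      = (if i = j then 1 / (1 + c j) else 1) * (1 / (1 + c i)) := by
    intro i
    split_ifs with hi
    · rw [integral_sq_mul_exp_neg_mul_sq_complexNormal (hc i), hi, sq, div_mul_div_comm, one_mul]
    · simp only [one_mul]
      exact integral_exp_neg_mul_sq_complexNormal (hc i)
  simp only [h1, Finset.prod_mul_distrib, Finset.prod_ite_eq', Finset.mem_univ, if_true,
    ← Real.exp_sum] at h
  rw [← h, channelLaw]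
  simp only [neg_mul, Finset.sum_neg_distrib]

end Wiretap

/-! ### Diagonal entries as Laplace integrals -/

namespace Wiretap

/-- The diagonal entries of `expectedOuter d`. -/
noncomputable def outerDiag {n : ℕ} (d : Fin n → ℝ) (j : Fin n) : ℝ :=
  ∫ g, ‖g j‖ ^ 2 / (1 + ∑ l, d l * ‖g l‖ ^ 2) ∂channelLaw n

theorem expectedOuter_self {n : ℕ} (d : Fin n → ℝ) (j : Fin n) :
    expectedOuter d j j = (outerDiag d j : ℂ) := by
  rw [expectedOuter, outerDiag, Matrix.of_apply, ← integral_complex_ofReal]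
  refine integral_congr_ae (Filter.Eventually.of_forall fun g => ?_)
  simp only [Complex.mul_conj, Complex.normSq_eq_norm_sq, Complex.ofReal_div]

theorem measurable_outer {n : ℕ} (d : Fin n → ℝ) (j : Fin n) :
    Measurable fun g : Fin n → ℂ => ‖g j‖ ^ 2 / (1 + ∑ l, d l * ‖g l‖ ^ 2) := by
  fun_prop

theorem one_le_one_add_sum {n : ℕ} {d : Fin n → ℝ} (hd : ∀ i, 0 ≤ d i) (g : Fin n → ℂ) :
    1 ≤ 1 + ∑ l, d l * ‖g l‖ ^ 2 :=
  le_add_of_nonneg_right (Finset.sum_nonneg fun i _ => mul_nonneg (hd i) (sq_nonneg _))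

theorem integrable_outer {n : ℕ} {d : Fin n → ℝ} (hd : ∀ i, 0 ≤ d i) (j : Fin n) :
    Integrable (fun g : Fin n → ℂ => ‖g j‖ ^ 2 / (1 + ∑ l, d l * ‖g l‖ ^ 2)) (channelLaw n) := by
  refine (integrable_sq_channelLaw j).mono' (measurable_outer d j).aestronglyMeasurable
    (Filter.Eventually.of_forall fun g => ?_)
  have h := one_le_one_add_sum hd g
  rw [Real.norm_of_nonneg (by positivity)]
  exact div_le_self (sq_nonneg _) h

theorem integrableOn_mul_exp_neg_mul (c : ℝ) {q : ℝ} (hq : 0 < q) :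
    IntegrableOn (fun t => c * Real.exp (-t * q)) (Set.Ioi 0) := by
  have := (integrableOn_exp_mul_Ioi (neg_neg_of_pos hq) 0).const_mul c
  refine this.congr (Filter.Eventually.of_forall fun t => ?_)
  simp only [neg_mul, mul_comm q]

theorem integral_mul_exp_neg_mul (c : ℝ) {q : ℝ} (hq : 0 < q) :
    ∫ t in Set.Ioi (0 : ℝ), c * Real.exp (-t * q) = c / q := by
  have := integral_exp_mul_Ioi (neg_neg_of_pos hq) 0
  rw [integral_const_mul]
  simp only [neg_mul, mul_zero, Real.exp_zero, neg_div_neg_eq, mul_comm q] at this ⊢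
  rw [this, mul_one_div]

theorem outerDiag_eq_integral {n : ℕ} {d : Fin n → ℝ} (hd : ∀ i, 0 ≤ d i) (j : Fin n) :
    outerDiag d j = ∫ t in Set.Ioi (0 : ℝ),
      Real.exp (-t) * (1 / (1 + d j * t) * ∏ l, 1 / (1 + d l * t)) := by
  have hQ : ∀ g : Fin n → ℂ, 0 < 1 + ∑ l, d l * ‖g l‖ ^ 2 := fun g =>
    zero_lt_one.trans_le (one_le_one_add_sum hd g)
  -- For Fubini: the integrand is nonnegative and its `t`-integral is the integrand of `outerDiag`,
  -- known to be integrable.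
  have hint : Integrable (Function.uncurry fun (g : Fin n → ℂ) (t : ℝ) =>
      ‖g j‖ ^ 2 * Real.exp (-t * (1 + ∑ l, d l * ‖g l‖ ^ 2)))
      ((channelLaw n).prod (volume.restrict (Set.Ioi 0))) := by
    rw [integrable_prod_iff (Measurable.aestronglyMeasurable (by fun_prop))]
    refine ⟨Filter.Eventually.of_forall fun g =>
      integrableOn_mul_exp_neg_mul (‖g j‖ ^ 2) (hQ g), ?_⟩
    refine (integrable_outer hd j).congr (Filter.Eventually.of_forall fun g => ?_)
    simp only [Function.uncurry]
    rw [← integral_mul_exp_neg_mul _ (hQ g)]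
    refine integral_congr_ae (Filter.Eventually.of_forall fun t => ?_)
    exact (Real.norm_of_nonneg (by positivity)).symm
  have h1 : outerDiag d j = ∫ g, (∫ t in Set.Ioi (0 : ℝ),
      ‖g j‖ ^ 2 * Real.exp (-t * (1 + ∑ l, d l * ‖g l‖ ^ 2))) ∂channelLaw n :=
    integral_congr_ae (Filter.Eventually.of_forall fun g => (integral_mul_exp_neg_mul _ (hQ g)).symm)
  rw [h1, integral_integral_swap hint]
  refine setIntegral_congr_fun measurableSet_Ioi fun t ht => ?_
  have h2 := integral_sq_mul_exp_channelLaw (fun l => d l * t)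
    (fun l => mul_nonneg (hd l) (le_of_lt ht)) j
  rw [← h2, ← integral_const_mul]
  refine integral_congr_ae (Filter.Eventually.of_forall fun g => ?_)
  simp only
  rw [mul_add, Real.exp_add, mul_one, ← Finset.sum_neg_distrib, Finset.mul_sum]
  rw [mul_left_comm]
  congr 4
  ext l
  ring

/-! ### Partial fractions -/

section PartialFractions

variable {x y : ℝ}

theorem A2_eq (hx : x ≠ 0) (m : ℕ) : A2 (m + 1) x y = (x / (x - y)) ^ m := by
  rw [A2, one_sub_div hx, Nat.add_sub_cancel, ← one_div_pow, one_div_div]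

theorem A3_eq (hx : x ≠ 0) (n : ℕ) : A3 n x y = (x / (x - y)) ^ n := by
  rw [A3, one_sub_div hx, ← one_div_pow, one_div_div]

theorem A1_eq (hx : x ≠ 0) (m : ℕ) :
    A1 (m + 1) x y = m * (x / (x - y)) ^ m * (y / (y - x)) := by
  have h : y / (y - x) = -(x / (x - y)) * (y / x) := by
    rw [neg_mul, div_mul_div_comm, mul_comm (x - y), mul_div_mul_left _ _ hx, ← neg_sub x y,
      div_neg]
  have h2 : A1 (m + 1) x y = -m * A3 (m + 1) x y * (y / x) := by
    rw [A1, A3]; push_cast; ring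
  rw [h2, A3_eq hx, h]
  ring

theorem neg_div_mul_div_sub (hy : y ≠ 0) : -(x / y) * (y / (y - x)) = x / (x - y) := by
  rw [neg_mul, div_mul_div_comm, mul_comm x, mul_div_mul_left _ _ hy, ← neg_sub x y, div_neg,
    neg_neg]

theorem C_eq (hy : y ≠ 0) (n k : ℕ) :
    C n x y k = (x / (x - y)) ^ (n - k) * (y / (y - x)) := by
  rw [C, ← neg_div_mul_div_sub hy, one_sub_div hy, mul_pow, mul_assoc, ← pow_succ, div_eq_mul_inv,
    ← inv_pow, inv_div]

theorem B_eq (hy : y ≠ 0) {m k : ℕ} (hk : k ≤ m) :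
    B (m + 1) x y k = (m + 1 - k) * (x / (x - y)) ^ (m - k) * (y / (y - x)) ^ 2 := by
  rw [B, ← neg_div_mul_div_sub hy, one_sub_div hy, mul_pow, mul_assoc, mul_assoc, ← pow_add,
    div_eq_mul_inv, ← inv_pow, inv_div, Nat.add_sub_cancel, Nat.sub_add_comm hk]
  push_cast
  ring

/-- The relation `huv` is all that is needed of `u = 1 + x t`, `v = 1 + y t`. With `α = x / (x - y)`
and `β = y / (y - x)`, every coefficient is a monomial in `α`, `β` up to an integer factor, so both
expansions follow by induction from this case. -/
theorem one_div_mul_eq (hxy : y ≠ x) {u v : ℝ} (hu : u ≠ 0) (hv : v ≠ 0)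
    (huv : x * v - y * u = x - y) :
    1 / (u * v) = x / (x - y) / u + y / (y - x) / v := by
  have h1 : x - y ≠ 0 := sub_ne_zero.2 hxy.symm
  rw [← neg_sub x y, div_neg]
  field_simp
  linear_combination -huv

theorem partialFraction_C (hx : x ≠ 0) (hy : y ≠ 0) (hxy : y ≠ x) {u v : ℝ} (hu : u ≠ 0)
    (hv : v ≠ 0) (huv : x * v - y * u = x - y) (n : ℕ) :
    1 / (u * v ^ n) = A3 n x y / u + ∑ k ∈ Finset.Icc 1 n, C n x y k / v ^ k := by
  have hb := one_div_mul_eq hxy hu hv huv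
  simp only [A3_eq hx, C_eq hy]
  generalize x / (x - y) = α at hb ⊢
  generalize y / (y - x) = β at hb ⊢
  induction n with
  | zero => simp
  | succ n ih =>
    have e1 : 1 / (u * v ^ (n + 1)) = α * (1 / (u * v ^ n)) + β / v ^ (n + 1) := by
      rw [pow_succ', ← mul_assoc, ← one_div_mul_one_div, hb]
      field_simp
    have e2 : ∀ k ∈ Finset.Icc 1 n, α ^ (n + 1 - k) * β / v ^ k
        = α * (α ^ (n - k) * β / v ^ k) := by
      intro k hk
      rw [Nat.sub_add_comm (Finset.mem_Icc.1 hk).2]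
      ring
    rw [e1, ih, Finset.sum_Icc_succ_top (by omega), Finset.sum_congr rfl e2, ← Finset.mul_sum,
      Nat.sub_self]
    ring

theorem partialFraction_B (hx : x ≠ 0) (hy : y ≠ 0) (hxy : y ≠ x) {u v : ℝ} (hu : u ≠ 0)
    (hv : v ≠ 0) (huv : x * v - y * u = x - y) (m : ℕ) :
    1 / (u ^ 2 * v ^ m) = A1 (m + 1) x y / u + A2 (m + 1) x y / u ^ 2
      + ∑ k ∈ Finset.Icc 1 m, B (m + 1) x y k / v ^ k := by
  have hb := one_div_mul_eq hxy hu hv huv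
  have hC := partialFraction_C hx hy hxy hu hv huv
  rw [A1_eq hx, A2_eq hx, Finset.sum_congr rfl fun k hk => by
    rw [B_eq hy (Finset.mem_Icc.1 hk).2]]
  simp only [A3_eq hx, C_eq hy] at hC
  generalize x / (x - y) = α at hb hC ⊢
  generalize y / (y - x) = β at hb hC ⊢
  induction m with
  | zero => simp
  | succ m ih =>
    -- Splitting one factor `1 / (u v)` lowers the power of `v` in one term and that of `u` in the
    -- other; the latter is covered by `partialFraction_C`.
    have e1 : 1 / (u ^ 2 * v ^ (m + 1))
        = α * (1 / (u ^ 2 * v ^ m)) + β * (1 / (u * v ^ (m + 1))) := by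
      rw [pow_succ' v, sq, show u * u * (v * v ^ m) = u * v * (u * v ^ m) by ring,
        ← one_div_mul_one_div (u * v), hb]
      field_simp
    have e2 : ∀ k ∈ Finset.Icc 1 m,
        (((m + 1 : ℕ) : ℝ) + 1 - k) * α ^ (m + 1 - k) * β ^ 2 / v ^ k
        = α * ((m + 1 - k) * α ^ (m - k) * β ^ 2 / v ^ k)
          + β * (α ^ (m + 1 - k) * β / v ^ k) := by
      intro k hk
      rw [Nat.sub_add_comm (Finset.mem_Icc.1 hk).2]
      push_cast
      ring
    rw [e1, ih, hC, Finset.sum_Icc_succ_top (by omega), Finset.sum_Icc_succ_top (by omega),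
      Finset.sum_congr rfl e2, Finset.sum_add_distrib, ← Finset.mul_sum, ← Finset.mul_sum,
      Nat.sub_self]
    push_cast
    ring

end PartialFractions

end Wiretap

/-! ### Closed forms of the two left-hand sides -/

namespace Wiretap

theorem diagEntries_nonneg {n : ℕ} [NeZero n] {x y : ℝ} (hx : 0 ≤ x) (hy : 0 ≤ y) (i : Fin n) :
    0 ≤ diagEntries n x y i := by
  unfold diagEntries; split_ifs <;> assumption

theorem integrableOn_exp_neg_div_pow (k : ℕ) {x : ℝ} (hx : 0 ≤ x) :
    IntegrableOn (fun t => Real.exp (-t) / (1 + x * t) ^ k) (Set.Ioi 0) := by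
  have h0 : IntegrableOn (fun t : ℝ => Real.exp (-t)) (Set.Ioi 0) := by
    simpa using integrableOn_exp_mul_Ioi (neg_one_lt_zero (R := ℝ)) 0
  refine Integrable.mono' h0 (Measurable.aestronglyMeasurable (by fun_prop))
    ((ae_restrict_mem measurableSet_Ioi).mono fun t ht => ?_)
  have ht : 0 < t := ht
  have h1 : 1 ≤ (1 + x * t) ^ k := one_le_pow₀ (le_add_of_nonneg_right (by positivity))
  rw [Real.norm_of_nonneg (by positivity)]
  exact div_le_self (Real.exp_pos _).le h1

theorem integral_exp_neg_div_pow (k : ℕ) {x : ℝ} (hx : 0 < x) :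
    ∫ t in Set.Ioi (0 : ℝ), Real.exp (-t) / (1 + x * t) ^ k = F k x / x := by
  rw [F]
  simp only [mul_div_assoc]
  rw [integral_const_mul, mul_div_cancel_left₀ _ hx.ne']

theorem prod_diagEntries {m : ℕ} (x y t : ℝ) :
    ∏ l, 1 / (1 + diagEntries (m + 1) x y l * t) = 1 / ((1 + x * t) * (1 + y * t) ^ m) := by
  rw [Fin.prod_univ_succ]
  simp [diagEntries, Fin.succ_ne_zero, mul_comm]

theorem outerDiag_zero_eq {m : ℕ} {x y : ℝ} (hx : 0 < x) (hy : 0 < y) (hxy : y ≠ x) :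
    outerDiag (diagEntries (m + 1) x y) 0 = A1 (m + 1) x y / x * F 1 x
      + A2 (m + 1) x y / x * F 2 x + ∑ k ∈ Finset.Icc 1 m, B (m + 1) x y k / y * F k y := by
  have h1 : ∀ t ∈ Set.Ioi (0 : ℝ), Real.exp (-t) * (1 / (1 + diagEntries (m + 1) x y 0 * t)
      * ∏ l, 1 / (1 + diagEntries (m + 1) x y l * t))
      = A1 (m + 1) x y * (Real.exp (-t) / (1 + x * t) ^ 1)
        + A2 (m + 1) x y * (Real.exp (-t) / (1 + x * t) ^ 2)
        + ∑ k ∈ Finset.Icc 1 m, B (m + 1) x y k * (Real.exp (-t) / (1 + y * t) ^ k) := by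
    intro t ht
    have ht : 0 < t := ht
    have h := partialFraction_B hx.ne' hy.ne' hxy (u := 1 + x * t) (v := 1 + y * t)
      (by positivity) (by positivity) (by ring) m
    rw [prod_diagEntries, show diagEntries (m + 1) x y 0 = x from if_pos rfl, one_div_mul_one_div,
      ← mul_assoc, ← sq, h, mul_add, mul_add, Finset.mul_sum, pow_one]
    congr 1
    · ring
    · exact Finset.sum_congr rfl fun k _ => by ring
  have hix := fun k => integrableOn_exp_neg_div_pow k hx.le
  have hiy := fun k => integrableOn_exp_neg_div_pow k hy.le
  rw [outerDiag_eq_integral (diagEntries_nonneg hx.le hy.le),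
    setIntegral_congr_fun measurableSet_Ioi h1, integral_add
      (((hix 1).const_mul _).fun_add ((hix 2).const_mul _))
      (integrable_finsetSum _ fun k _ => (hiy k).const_mul _),
    integral_add ((hix 1).const_mul _) ((hix 2).const_mul _),
    integral_finsetSum _ fun k _ => (hiy k).const_mul _]
  simp only [integral_const_mul, integral_exp_neg_div_pow _ hx, integral_exp_neg_div_pow _ hy]
  congr 1
  · ring
  · exact Finset.sum_congr rfl fun k _ => by ring

theorem outerDiag_succ_eq {m : ℕ} {x y : ℝ} (hx : 0 < x) (hy : 0 < y) (hxy : y ≠ x) (i : Fin m) :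
    outerDiag (diagEntries (m + 1) x y) i.succ = A3 (m + 1) x y / x * F 1 x
      + ∑ k ∈ Finset.Icc 1 (m + 1), C (m + 1) x y k / y * F k y := by
  have h1 : ∀ t ∈ Set.Ioi (0 : ℝ), Real.exp (-t) * (1 / (1 + diagEntries (m + 1) x y i.succ * t)
      * ∏ l, 1 / (1 + diagEntries (m + 1) x y l * t))
      = A3 (m + 1) x y * (Real.exp (-t) / (1 + x * t) ^ 1)
        + ∑ k ∈ Finset.Icc 1 (m + 1), C (m + 1) x y k * (Real.exp (-t) / (1 + y * t) ^ k) := by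
    intro t ht
    have ht : 0 < t := ht
    have h := partialFraction_C hx.ne' hy.ne' hxy (u := 1 + x * t) (v := 1 + y * t)
      (by positivity) (by positivity) (by ring) (m + 1)
    rw [prod_diagEntries, show diagEntries (m + 1) x y i.succ = y from if_neg (Fin.succ_ne_zero i),
      one_div_mul_one_div, mul_left_comm, ← pow_succ', h, mul_add, Finset.mul_sum, pow_one]
    congr 1
    · ring
    · exact Finset.sum_congr rfl fun k _ => by ring
  have hix := fun k => integrableOn_exp_neg_div_pow k hx.le
  have hiy := fun k => integrableOn_exp_neg_div_pow k hy.le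
  rw [outerDiag_eq_integral (diagEntries_nonneg hx.le hy.le),
    setIntegral_congr_fun measurableSet_Ioi h1, integral_add ((hix 1).const_mul _)
      (integrable_finsetSum _ fun k _ => (hiy k).const_mul _),
    integral_finsetSum _ fun k _ => (hiy k).const_mul _]
  simp only [integral_const_mul, integral_exp_neg_div_pow _ hx, integral_exp_neg_div_pow _ hy]
  congr 1
  · ring
  · exact Finset.sum_congr rfl fun k _ => by ring

/-- The trace of `expectedOuter (diagEntries n x y)` over the directions orthogonal to the
main channel. -/
noncomputable def orthTrace (n : ℕ) [NeZero n] (x y : ℝ) : ℝ :=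
  ∑ i ∈ Finset.univ.erase (0 : Fin n), outerDiag (diagEntries n x y) i

theorem sum_erase_zero {M : Type*} [AddCommMonoid M] {m : ℕ} (f : Fin (m + 1) → M) :
    ∑ i ∈ Finset.univ.erase (0 : Fin (m + 1)), f i = ∑ i : Fin m, f i.succ := by
  rw [Fin.univ_succ, Finset.erase_cons, Finset.sum_map]
  rfl

theorem orthTrace_eq {m : ℕ} {x y : ℝ} (hx : 0 < x) (hy : 0 < y) (hxy : y ≠ x) :
    orthTrace (m + 1) x y = m * (A3 (m + 1) x y / x * F 1 x
      + ∑ k ∈ Finset.Icc 1 (m + 1), C (m + 1) x y k / y * F k y) := by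
  rw [orthTrace, sum_erase_zero]
  simp [outerDiag_succ_eq hx hy hxy, mul_add]

theorem secondLHS_eq {n : ℕ} [NeZero n] {PU PV1 PV2 : ℝ} (hU : 0 ≤ PU) (hV1 : 0 < PV1)
    (hV2 : 0 < PV2) (hne : PV2 ≠ PV1) (hne' : PV2 ≠ PU + PV1) :
    secondLHS n PU PV1 PV2 = outerDiag (diagEntries n PV1 PV2) 0
      - outerDiag (diagEntries n (PU + PV1) PV2) 0 := by
  obtain ⟨m, rfl⟩ := Nat.exists_eq_succ_of_ne_zero (NeZero.ne n)
  rw [outerDiag_zero_eq hV1 hV2 hne, outerDiag_zero_eq (by positivity) hV2 hne', secondLHS]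
  simp only [Nat.succ_eq_add_one, Nat.add_sub_cancel]
  ring

/-- The two terms of `firstLHS` free of `F` combine to `-PV1 * r`; the rest regroups into the
direction of `h` and the orthogonal ones. Both implications of the theorem rest on this splitting.
-/
theorem firstLHS_eq {n : ℕ} [NeZero n] {η PU PV1 PV2 : ℝ} (hη : 0 ≤ η) (hU : 0 ≤ PU)
    (hV1 : 0 < PV1) (hV2 : 0 < PV2) (hne : PV2 ≠ PV1) (hne' : PV2 ≠ PU + PV1) :
    firstLHS n η PU PV1 PV2 = PV1 * secondLHS n PU PV1 PV2
      + PV2 * (orthTrace n PV1 PV2 - orthTrace n (PU + PV1) PV2) - PV1 * secondRHS η PU PV1 := by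
  obtain ⟨m, rfl⟩ := Nat.exists_eq_succ_of_ne_zero (NeZero.ne n)
  have hb : 0 < PU + PV1 := by positivity
  rw [orthTrace_eq hV1 hV2 hne, orthTrace_eq hb hV2 hne', firstLHS, secondLHS, secondRHS]
  simp only [Nat.succ_eq_add_one, Nat.add_sub_cancel, div_mul_eq_mul_div _ PV2, ← Finset.sum_div]
  have hlog : 1 / (1 + η * PV1) - (1 + η * PU) / (1 + η * (PU + PV1))
      = -(PV1 * (η ^ 2 * PU / ((1 + η * PV1) * (1 + η * (PU + PV1))))) := by
    field_simp
    ring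
  rw [hlog]
  push_cast
  field_simp
  ring

end Wiretap

/-! ### Rates for general gains: the case of zero optimal rate -/

namespace Wiretap

section RateAnalysis

open Filter Topology

variable {Ω : Type*} [MeasurableSpace Ω] {μ : Measure Ω}

theorem integral_lt_integral_of_ae_lt [NeZero μ] {f g : Ω → ℝ} (hf : Integrable f μ)
    (hg : Integrable g μ) (h : ∀ᵐ ω ∂μ, f ω < g ω) : ∫ ω, f ω ∂μ < ∫ ω, g ω ∂μ := by
  rw [← sub_pos, ← integral_sub hg hf, integral_pos_iff_support_of_nonneg_ae
    (h.mono fun ω hω => sub_nonneg.2 hω.le) (hg.sub hf)]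
  refine pos_iff_ne_zero.2 fun h0 => ?_
  have h1 : ∀ᵐ ω ∂μ, ω ∉ Function.support fun ω => g ω - f ω := measure_eq_zero_iff_ae_notMem.1 h0
  obtain ⟨ω, hω, hω'⟩ := (h.and h1).exists
  exact hω' (sub_pos.2 hω).ne'

/-- A pair of nonnegative integrable gains which are almost surely positive. -/
structure IsGainPair (μ : Measure Ω) (G S : Ω → ℝ) : Prop where
  measurable_left : Measurable G
  measurable_right : Measurable S
  integrable_left : Integrable G μ
  integrable_right : Integrable S μ
  left_nonneg : ∀ ω, 0 ≤ G ω
  right_nonneg : ∀ ω, 0 ≤ S ω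
  left_pos : ∀ᵐ ω ∂μ, 0 < G ω
  right_pos : ∀ᵐ ω ∂μ, 0 < S ω

/-- The difference of the rates over a fixed channel with gain `η` and over a fading channel with
gain `G` and noise gain `S`. -/
noncomputable def gainRate (μ : Measure Ω) (G S : Ω → ℝ) (η p x y : ℝ) : ℝ :=
  Real.log (1 + η * p / (1 + η * x)) - ∫ ω, Real.log (1 + G ω * p / (1 + G ω * x + S ω * y)) ∂μ

variable {G S : Ω → ℝ} {η p x x' y y' : ℝ}

namespace IsGainPair

theorem one_le (hGS : IsGainPair μ G S) (hx : 0 ≤ x) (hy : 0 ≤ y) (ω : Ω) :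
    1 ≤ 1 + x * G ω + y * S ω := by
  have := mul_nonneg hx (hGS.left_nonneg ω)
  have := mul_nonneg hy (hGS.right_nonneg ω)
  linarith

theorem integrable_div (hGS : IsGainPair μ G S) {W : Ω → ℝ} (hW : Integrable W μ) (hx : 0 ≤ x)
    (hy : 0 ≤ y) : Integrable (fun ω => W ω / (1 + x * G ω + y * S ω)) μ := by
  have := hGS.measurable_left
  have := hGS.measurable_right
  refine hW.mono (hW.aestronglyMeasurable.div₀ (Measurable.aestronglyMeasurable (by fun_prop)))
    (Eventually.of_forall fun ω => ?_)
  have h1 := hGS.one_le hx hy ω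
  rw [norm_div, Real.norm_of_nonneg (zero_le_one.trans h1)]
  exact div_le_self (norm_nonneg _) h1

theorem integral_div_lt_left [NeZero μ] (hGS : IsGainPair μ G S) {W : Ω → ℝ} (hW : Integrable W μ)
    (hW0 : ∀ᵐ ω ∂μ, 0 < W ω) (hx : 0 ≤ x) (hy : 0 ≤ y) (hxx : x < x') :
    ∫ ω, W ω / (1 + x' * G ω + y * S ω) ∂μ < ∫ ω, W ω / (1 + x * G ω + y * S ω) ∂μ := by
  refine integral_lt_integral_of_ae_lt (hGS.integrable_div hW (hx.trans hxx.le) hy)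
    (hGS.integrable_div hW hx hy) ?_
  filter_upwards [hW0, hGS.left_pos] with ω h1 h2
  have h3 := hGS.one_le hx hy ω
  gcongr

theorem integral_div_lt_right [NeZero μ] (hGS : IsGainPair μ G S) {W : Ω → ℝ}
    (hW : Integrable W μ) (hW0 : ∀ᵐ ω ∂μ, 0 < W ω) (hx : 0 ≤ x) (hy : 0 ≤ y) (hyy : y < y') :
    ∫ ω, W ω / (1 + x * G ω + y' * S ω) ∂μ < ∫ ω, W ω / (1 + x * G ω + y * S ω) ∂μ := by
  refine integral_lt_integral_of_ae_lt (hGS.integrable_div hW hx (hy.trans hyy.le))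
    (hGS.integrable_div hW hx hy) ?_
  filter_upwards [hW0, hGS.right_pos] with ω h1 h2
  have h3 := hGS.one_le hx hy ω
  gcongr

/-- Bound the fading logarithm by `log (1 + u) ≤ u` and the fixed one by `log w ≥ 1 - 1 / w`, then
divide by `p`. -/
theorem le_integral_div_of_gainRate_nonpos (hGS : IsGainPair μ G S) (hη : 0 ≤ η) (hp : 0 < p)
    (hx : 0 ≤ x) (hy : 0 ≤ y) (h : gainRate μ G S η p x y ≤ 0) :
    η / (1 + η * (x + p)) ≤ ∫ ω, G ω / (1 + x * G ω + y * S ω) ∂μ := by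
  have hm1 := hGS.measurable_left
  have hm2 := hGS.measurable_right
  have hQ : ∀ ω, 1 + G ω * x + S ω * y = 1 + x * G ω + y * S ω := fun ω => by ring
  have hu : ∀ ω, 0 ≤ p * (G ω / (1 + x * G ω + y * S ω)) := fun ω =>
    mul_nonneg hp.le (div_nonneg (hGS.left_nonneg ω) (zero_le_one.trans (hGS.one_le hx hy ω)))
  have h1 : ∫ ω, Real.log (1 + G ω * p / (1 + G ω * x + S ω * y)) ∂μ
      ≤ ∫ ω, p * (G ω / (1 + x * G ω + y * S ω)) ∂μ := by
    refine integral_mono_of_nonneg (Eventually.of_forall fun ω => ?_)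
      ((hGS.integrable_div hGS.integrable_left hx hy).const_mul p)
      (Eventually.of_forall fun ω => ?_)
    · simp only [hQ, mul_comm _ p, mul_div_assoc]
      exact Real.log_nonneg (le_add_of_nonneg_right (hu ω))
    · simp only [hQ, mul_comm _ p, mul_div_assoc]
      have := Real.log_le_sub_one_of_pos (x := 1 + p * (G ω / (1 + x * G ω + y * S ω)))
        (by linarith [hu ω])
      linarith
  have h2 : 1 - (1 + η * p / (1 + η * x))⁻¹ ≤ Real.log (1 + η * p / (1 + η * x)) :=
    Real.one_sub_inv_le_log_of_pos (by positivity)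
  have h3 : 1 - (1 + η * p / (1 + η * x))⁻¹ = p * (η / (1 + η * (x + p))) := by
    field_simp
    ring
  rw [integral_const_mul] at h1
  rw [gainRate] at h
  refine le_of_mul_le_mul_left ?_ hp
  linarith

/-- Nearly all signal power is moved into noise, either orthogonal (`h1`) or along the main channel
(`h2`). As `ε → 0` this bounds the expectations of `a = G / (1 + x G + y S)` and `b = G / (1 + (p +
x) G + y S)` below by their values `qx`, `qb` for the fixed channel. Then `a - b = p a b` and `(a -
qx) (b - qb) ≥ 0` give the claim. -/
theorem lt_integral_sub_integral_of_gainRate_nonpos [IsProbabilityMeasure μ]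
    (hGS : IsGainPair μ G S) {c : ℝ} (hc : 0 < c) (hη : 0 ≤ η) (hp : 0 < p) (hx : 0 < x)
    (hy : 0 < y)
    (h1 : ∀ ε, 0 < ε → ε < p → gainRate μ G S η ε x (y + c * (p - ε)) ≤ 0)
    (h2 : ∀ ε, 0 < ε → ε < p → gainRate μ G S η ε (p + x - ε) y ≤ 0) :
    η ^ 2 * p / ((1 + η * x) * (1 + η * (p + x)))
      < (∫ ω, G ω / (1 + x * G ω + y * S ω) ∂μ)
        - ∫ ω, G ω / (1 + (p + x) * G ω + y * S ω) ∂μ := by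
  have hb : 0 < p + x := by positivity
  have hmono := fun {z z' : ℝ} (hz : 0 ≤ z) (hzz : z < z') =>
    hGS.integral_div_lt_right hGS.integrable_left hGS.left_pos hx.le hz hzz
  have hlt : η / (1 + η * x) < ∫ ω, G ω / (1 + x * G ω + y * S ω) ∂μ := by
    -- A limit keeps only `≤`. The intermediate noise power `y + c p / 2`, below `y + c (p - ε)` for
    -- all `ε < p / 2`, keeps the inequality strict.
    refine lt_of_le_of_lt ?_ (hmono hy.le (z' := y + c * (p / 2)) (by
      have : 0 < c * (p / 2) := by positivity
      linarith))
    have ht : Tendsto (fun ε => η / (1 + η * (x + ε))) (𝓝[>] 0) (𝓝 (η / (1 + η * (x + 0)))) := by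
      refine tendsto_nhdsWithin_of_tendsto_nhds (ContinuousAt.tendsto ?_)
      have : 1 + η * (x + 0) ≠ 0 := by positivity
      fun_prop (disch := assumption)
    rw [add_zero] at ht
    refine le_of_tendsto ht ?_
    filter_upwards [Ioo_mem_nhdsGT (half_pos hp)] with ε hε
    have hεp : ε < p := hε.2.trans (half_lt_self hp)
    refine (hGS.le_integral_div_of_gainRate_nonpos hη hε.1 hx.le
      (by have := mul_pos hc (sub_pos.2 hεp); positivity) (h1 ε hε.1 hεp)).trans (hmono
      (by positivity) ?_).le
    have : p / 2 < p - ε := by linarith [hε.2]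
    gcongr
  have hle : η / (1 + η * (p + x)) ≤ ∫ ω, G ω / (1 + (p + x) * G ω + y * S ω) ∂μ := by
    refine le_of_mul_le_mul_left ?_ hb
    -- The factor `z = p + x - ε` is included because `z G / (1 + z G + y S)` increases with `z`,
    -- which allows replacing `z` by `p + x`.
    have ht : Tendsto (fun ε => (p + x - ε) * (η / (1 + η * (p + x)))) (𝓝[>] 0)
        (𝓝 ((p + x - 0) * (η / (1 + η * (p + x))))) := by
      refine tendsto_nhdsWithin_of_tendsto_nhds (ContinuousAt.tendsto ?_)
      fun_prop
    rw [sub_zero] at ht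
    refine le_of_tendsto ht ?_
    filter_upwards [Ioo_mem_nhdsGT hp] with ε hε
    have hd : 0 < p + x - ε := by linarith [hε.2]
    have h3 := hGS.le_integral_div_of_gainRate_nonpos hη hε.1 hd.le hy.le (h2 ε hε.1 hε.2)
    rw [sub_add_cancel] at h3
    refine (mul_le_mul_of_nonneg_left h3 hd.le).trans ?_
    rw [← integral_const_mul, ← integral_const_mul]
    refine integral_mono ((hGS.integrable_div hGS.integrable_left hd.le hy.le).const_mul _)
      ((hGS.integrable_div hGS.integrable_left hb.le hy.le).const_mul _) fun ω => ?_
    have hG := hGS.left_nonneg ω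
    have hS := hGS.right_nonneg ω
    simp only [mul_div_left_comm _ (G ω)]
    refine mul_le_mul_of_nonneg_left ?_ hG
    rw [div_le_div_iff₀ (by positivity) (by positivity)]
    nlinarith [mul_nonneg hε.1.le (mul_nonneg hy.le hS), hε.1]
  have ha1 := hGS.integrable_div hGS.integrable_left hx.le hy.le
  have hb1 := hGS.integrable_div hGS.integrable_left hb.le hy.le
  rcases hη.eq_or_lt with rfl | hη0
  · have := hGS.integral_div_lt_left hGS.integrable_left hGS.left_pos hx.le hy.le
      (lt_add_of_pos_left x hp)
    simpa using this
  have hr : η ^ 2 * p / ((1 + η * x) * (1 + η * (p + x)))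
      = p * ((η / (1 + η * x)) * (η / (1 + η * (p + x)))) := by
    field_simp
  rw [hr]
  set qx := η / (1 + η * x) with hqx
  set qb := η / (1 + η * (p + x)) with hqb
  have hqx0 : 0 < qx := by positivity
  have hqb0 : 0 < qb := by positivity
  have hpoint : ∀ ω, p * (qx * (G ω / (1 + (p + x) * G ω + y * S ω))
      + qb * (G ω / (1 + x * G ω + y * S ω)) - qx * qb)
      ≤ G ω / (1 + x * G ω + y * S ω) - G ω / (1 + (p + x) * G ω + y * S ω) := by
    intro ω
    have hG := hGS.left_nonneg ω
    have hS := hGS.right_nonneg ω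
    have e1 : G ω / (1 + x * G ω + y * S ω) - G ω / (1 + (p + x) * G ω + y * S ω)
        = p * ((G ω / (1 + x * G ω + y * S ω)) * (G ω / (1 + (p + x) * G ω + y * S ω))) := by
      field_simp
      ring
    -- Both factors have the sign of `G - η (1 + y S)`.
    have e2 : (G ω / (1 + x * G ω + y * S ω) - qx) * (G ω / (1 + (p + x) * G ω + y * S ω) - qb)
        = (G ω - η * (1 + y * S ω)) ^ 2 / ((1 + x * G ω + y * S ω) * (1 + η * x)
          * ((1 + (p + x) * G ω + y * S ω) * (1 + η * (p + x)))) := by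
      rw [hqx, hqb, div_sub_div _ _ (by positivity) (by positivity),
        div_sub_div _ _ (by positivity) (by positivity), div_mul_div_comm]
      congr 1
      ring
    have e3 : 0 ≤ (G ω / (1 + x * G ω + y * S ω) - qx)
        * (G ω / (1 + (p + x) * G ω + y * S ω) - qb) := by
      rw [e2]; positivity
    rw [e1]
    refine mul_le_mul_of_nonneg_left ?_ hp.le
    linarith
  have hint := integral_mono ((((hb1.const_mul qx).fun_add (ha1.const_mul qb)).sub
    (integrable_const (qx * qb))).const_mul p) (ha1.sub hb1) hpoint
  simp only [Pi.sub_apply] at hint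
  rw [integral_sub ha1 hb1, integral_const_mul, integral_sub
    ((hb1.const_mul qx).fun_add (ha1.const_mul qb)) (integrable_const _),
    integral_add (hb1.const_mul qx) (ha1.const_mul qb), integral_const_mul, integral_const_mul] at hint
  simp only [integral_const, probReal_univ, one_smul] at hint
  refine lt_of_lt_of_le (mul_lt_mul_of_pos_left ?_ hp) hint
  have := mul_le_mul_of_nonneg_left hle hqx0.le
  have := mul_lt_mul_of_pos_left hlt hqb0
  linarith

end IsGainPair

end RateAnalysis

end Wiretap

/-! ### Stationarity when the optimal rate is positive -/

namespace Wiretap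

section RateAnalysis

open Filter Topology

variable {Ω : Type*} [MeasurableSpace Ω] {μ : Measure Ω} {G S : Ω → ℝ} {η p x y c : ℝ}

theorem eventually_sub_pos_and_add_mul_pos (hx : 0 < x) (hy : 0 < y) (c : ℝ) :
    ∀ᶠ t in 𝓝 (0 : ℝ), 0 < x - t ∧ 0 < y + c * t := by
  have h1 : Tendsto (fun t : ℝ => x - t) (𝓝 0) (𝓝 (x - 0)) :=
    tendsto_const_nhds.sub tendsto_id
  have h2 : Tendsto (fun t : ℝ => y + c * t) (𝓝 0) (𝓝 (y + c * 0)) :=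
    tendsto_const_nhds.add (tendsto_id.const_mul c)
  exact (h1.eventually_const_lt (by simpa using hx)).and
    (h2.eventually_const_lt (by simpa using hy))

namespace IsGainPair

theorem hasDerivAt_integral_log (hGS : IsGainPair μ G S) (hx : 0 < x) (hy : 0 < y) :
    Integrable (fun ω => Real.log (1 + x * G ω + y * S ω)) μ ∧
    HasDerivAt (fun t => ∫ ω, Real.log (1 + (x - t) * G ω + (y + c * t) * S ω) ∂μ)
      (c * (∫ ω, S ω / (1 + x * G ω + y * S ω) ∂μ) - ∫ ω, G ω / (1 + x * G ω + y * S ω) ∂μ) 0 := by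
  have hm1 := hGS.measurable_left
  have hm2 := hGS.measurable_right
  have hint : ∀ {x y : ℝ}, 0 ≤ x → 0 ≤ y →
      Integrable (fun ω => Real.log (1 + x * G ω + y * S ω)) μ := by
    intro x y hx hy
    refine ((hGS.integrable_left.const_mul x).fun_add (hGS.integrable_right.const_mul y)).mono'
      (Measurable.aestronglyMeasurable (by fun_prop)) (Eventually.of_forall fun ω => ?_)
    have h1 := hGS.one_le hx hy ω
    rw [Real.norm_of_nonneg (Real.log_nonneg h1)]
    linarith [Real.log_le_sub_one_of_pos (zero_lt_one.trans_le h1)]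
  refine ⟨hint hx.le hy.le, ?_⟩
  -- On this neighbourhood the denominators are at least `1`, so `|c S - G|` dominates the
  -- derivative.
  have hs : {t : ℝ | 0 ≤ x - t ∧ 0 ≤ y + c * t} ∈ 𝓝 (0 : ℝ) := by
    filter_upwards [eventually_sub_pos_and_add_mul_pos hx hy c] with t ht using ⟨ht.1.le, ht.2.le⟩
  have hD := hasDerivAt_integral_of_dominated_loc_of_deriv_le (μ := μ) (x₀ := (0 : ℝ)) hs
    (F := fun t ω => Real.log (1 + (x - t) * G ω + (y + c * t) * S ω))
    (F' := fun t ω => (c * S ω - G ω) / (1 + (x - t) * G ω + (y + c * t) * S ω))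
    (bound := fun ω => |c * S ω - G ω|)
    (Eventually.of_forall fun t => Measurable.aestronglyMeasurable (by fun_prop))
    (by simpa using hint hx.le hy.le)
    (Measurable.aestronglyMeasurable (by fun_prop))
    (Eventually.of_forall fun ω t ht => ?_)
    ((hGS.integrable_right.const_mul c).sub hGS.integrable_left).abs
    (Eventually.of_forall fun ω t ht => ?_)
  · refine hD.2.congr_deriv ?_
    simp only [sub_zero, mul_zero, add_zero, sub_div, mul_div_assoc]
    rw [integral_sub ((hGS.integrable_div hGS.integrable_right hx.le hy.le).const_mul c)
      (hGS.integrable_div hGS.integrable_left hx.le hy.le), integral_const_mul]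
  · have h1 := hGS.one_le ht.1 ht.2 ω
    rw [norm_div, Real.norm_of_nonneg (zero_le_one.trans h1)]
    exact div_le_self (norm_nonneg _) h1
  · have h1 := hGS.one_le ht.1 ht.2 ω
    have h2 : HasDerivAt (fun t => 1 + (x - t) * G ω + (y + c * t) * S ω)
        (c * S ω - G ω) t := by
      have h3 := ((((hasDerivAt_id t).const_sub x).mul_const (G ω)).const_add 1).add
        ((((hasDerivAt_id t).const_mul c).const_add y).mul_const (S ω))
      refine h3.congr_deriv ?_
      ring
    exact h2.log (zero_lt_one.trans_le h1).ne'

theorem gainRate_eq (hGS : IsGainPair μ G S) (hη : 0 ≤ η) (hp : 0 ≤ p) (hx : 0 < x)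
    (hy : 0 < y) :
    gainRate μ G S η p x y = Real.log (1 + η * (p + x)) - Real.log (1 + η * x)
      - ((∫ ω, Real.log (1 + (p + x) * G ω + y * S ω) ∂μ)
        - ∫ ω, Real.log (1 + x * G ω + y * S ω) ∂μ) := by
  rw [gainRate, ← integral_sub (hGS.hasDerivAt_integral_log (c := 0) (by positivity) hy).1
    (hGS.hasDerivAt_integral_log (c := 0) hx hy).1,
    ← Real.log_div (by positivity) (by positivity)]
  congr 2
  · field_simp
    ring
  · ext ω
    have hG := hGS.left_nonneg ω
    have hS := hGS.right_nonneg ω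
    rw [← Real.log_div (by positivity) (by positivity)]
    congr 1
    field_simp
    ring

/-- The signal power `p` stays fixed, so `x` and `p + x` both decrease by `t`; this is the vanishing
of the derivative at `t = 0`. -/
theorem stationary_of_isLocalMax (hGS : IsGainPair μ G S) (hη : 0 ≤ η) (hp : 0 ≤ p) (hx : 0 < x)
    (hy : 0 < y)
    (hmax : ∀ᶠ t in 𝓝 (0 : ℝ), gainRate μ G S η p (x - t) (y + c * t) ≤ gainRate μ G S η p x y) :
    (∫ ω, G ω / (1 + x * G ω + y * S ω) ∂μ) - (∫ ω, G ω / (1 + (p + x) * G ω + y * S ω) ∂μ)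
        - η ^ 2 * p / ((1 + η * x) * (1 + η * (p + x)))
      = c * ((∫ ω, S ω / (1 + x * G ω + y * S ω) ∂μ)
        - ∫ ω, S ω / (1 + (p + x) * G ω + y * S ω) ∂μ) := by
  have hlog : ∀ z : ℝ, 0 ≤ z →
      HasDerivAt (fun t => Real.log (1 + η * (z - t))) (-η / (1 + η * z)) 0 := by
    intro z hz
    have h3 := ((((hasDerivAt_id (0 : ℝ)).const_sub z).const_mul η).const_add 1).log
      (by simp only [id, sub_zero]; positivity)
    simpa using h3
  have hd := (((hlog (p + x) (by positivity)).sub (hlog x hx.le))).sub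
    ((hGS.hasDerivAt_integral_log (c := c) (x := p + x) (by positivity) hy).2.sub
      (hGS.hasDerivAt_integral_log (c := c) hx hy).2)
  have hloc : IsLocalMax (fun t => Real.log (1 + η * (p + x - t)) - Real.log (1 + η * (x - t))
      - ((∫ ω, Real.log (1 + (p + x - t) * G ω + (y + c * t) * S ω) ∂μ)
        - ∫ ω, Real.log (1 + (x - t) * G ω + (y + c * t) * S ω) ∂μ)) 0 := by
    filter_upwards [eventually_sub_pos_and_add_mul_pos hx hy c, hmax] with t ⟨h1, h2⟩ h3
    rw [hGS.gainRate_eq hη hp h1 h2, hGS.gainRate_eq hη hp hx hy] at h3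
    simpa only [add_sub_assoc, sub_zero, mul_zero, add_zero] using h3
  have h0 := hloc.hasDerivAt_eq_zero hd
  have hr : -η / (1 + η * (p + x)) - -η / (1 + η * x)
      = η ^ 2 * p / ((1 + η * x) * (1 + η * (p + x))) := by
    field_simp
    ring
  rw [hr] at h0
  linarith

end IsGainPair

end RateAnalysis

/-! ### Application to the Gaussian channel -/

/-- The total gain of the directions orthogonal to the main channel. -/
noncomputable def orthGain {n : ℕ} [NeZero n] (g : Fin n → ℂ) : ℝ :=
  ∑ i ∈ Finset.univ.erase (0 : Fin n), ‖g i‖ ^ 2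

variable {n : ℕ} [NeZero n]

theorem isGainPair_channelLaw (hn : 2 ≤ n) :
    IsGainPair (channelLaw n) (fun g => ‖g 0‖ ^ 2) orthGain where
  measurable_left := by fun_prop
  measurable_right := by unfold orthGain; fun_prop
  integrable_left := integrable_sq_channelLaw 0
  integrable_right := integrable_finsetSum _ fun i _ => integrable_sq_channelLaw i
  left_nonneg g := sq_nonneg _
  right_nonneg g := Finset.sum_nonneg fun i _ => sq_nonneg _
  left_pos := ae_sq_pos_channelLaw 0
  right_pos := by
    have h1 : (⟨1, hn⟩ : Fin n) ≠ 0 := by simp [Fin.ext_iff]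
    filter_upwards [ae_sq_pos_channelLaw (⟨1, hn⟩ : Fin n)] with g hg
    exact hg.trans_le (Finset.single_le_sum (f := fun i => ‖g i‖ ^ 2) (fun i _ => sq_nonneg _)
      (Finset.mem_erase.2 ⟨h1, Finset.mem_univ _⟩))

theorem rateDiff_eq_gainRate (h : EuclideanSpace ℂ (Fin n)) (PU PV1 PV2 : ℝ) :
    rateDiff h PU PV1 PV2
      = gainRate (channelLaw n) (fun g => ‖g 0‖ ^ 2) orthGain (‖h‖ ^ 2) PU PV1 PV2 := rfl

theorem one_add_sum_diagEntries (x y : ℝ) (g : Fin n → ℂ) :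
    1 + ∑ l, diagEntries n x y l * ‖g l‖ ^ 2 = 1 + x * ‖g 0‖ ^ 2 + y * orthGain g := by
  rw [← Finset.add_sum_erase _ _ (Finset.mem_univ (0 : Fin n)), orthGain, Finset.mul_sum, add_assoc,
    Finset.sum_congr rfl fun i hi => by rw [diagEntries, if_neg (Finset.ne_of_mem_erase hi)]]
  rw [diagEntries, if_pos rfl]

theorem outerDiag_zero_eq_integral (x y : ℝ) :
    outerDiag (diagEntries n x y) 0
      = ∫ g, ‖g 0‖ ^ 2 / (1 + x * ‖g 0‖ ^ 2 + y * orthGain g) ∂channelLaw n := by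
  simp only [outerDiag, one_add_sum_diagEntries]

theorem orthTrace_eq_integral {x y : ℝ} (hx : 0 ≤ x) (hy : 0 ≤ y) :
    orthTrace n x y
      = ∫ g, orthGain g / (1 + x * ‖g 0‖ ^ 2 + y * orthGain g) ∂channelLaw n := by
  simp only [orthTrace, outerDiag]
  rw [← integral_finsetSum _ fun i _ => integrable_outer (diagEntries_nonneg hx hy) i]
  simp only [one_add_sum_diagEntries, ← Finset.sum_div]
  rfl

theorem secondRHS_lt_of_isOptimal (hn : 2 ≤ n) (h : EuclideanSpace ℂ (Fin n))
    {PT PU PV1 PV2 : ℝ} (hopt : IsOptimal h PT PU PV1 PV2) (hU : 0 < PU) (hV1 : 0 < PV1)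
    (hV2 : 0 < PV2) :
    secondRHS (‖h‖ ^ 2) PU PV1 < outerDiag (diagEntries n PV1 PV2) 0
      - outerDiag (diagEntries n (PU + PV1) PV2) 0 := by
  have hGS := isGainPair_channelLaw hn
  obtain ⟨⟨-, -, -, hsum⟩, hmax⟩ := hopt
  have hn1 : (0 : ℝ) < n - 1 := by
    have : (2 : ℝ) ≤ n := by exact_mod_cast hn
    linarith
  -- Power `t` taken from elsewhere is shared equally by the `n - 1` orthogonal directions, which
  -- preserves the total.
  have hc : 0 < 1 / ((n : ℝ) - 1) := by positivity
  have hcn : ∀ t : ℝ, ((n : ℝ) - 1) * (1 / ((n : ℝ) - 1) * t) = t := fun t => by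
    field_simp
  rw [outerDiag_zero_eq_integral, outerDiag_zero_eq_integral]
  rcases lt_or_ge 0 (secrecyRate h PU PV1 PV2) with hpos | hnonpos
  · have hrate : secrecyRate h PU PV1 PV2 = rateDiff h PU PV1 PV2 := by
      rw [secrecyRate] at hpos ⊢
      exact max_eq_right (((lt_max_iff.1 hpos).resolve_left (lt_irrefl 0)).le)
    have hst := hGS.stationary_of_isLocalMax (η := ‖h‖ ^ 2) (c := 1 / ((n : ℝ) - 1))
      (by positivity) hU.le hV1 hV2 (by
        filter_upwards [eventually_sub_pos_and_add_mul_pos hV1 hV2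
          (1 / ((n : ℝ) - 1))] with t ⟨h1, h2⟩
        rw [← rateDiff_eq_gainRate, ← rateDiff_eq_gainRate, ← hrate]
        refine (le_max_right _ _).trans (hmax _ _ _ ⟨hU.le, h1.le, h2.le, ?_⟩)
        rw [mul_add, hcn, ← hsum]
        ring)
    have hJ := hGS.integral_div_lt_left hGS.integrable_right hGS.right_pos hV1.le hV2.le
      (lt_add_of_pos_left PV1 hU)
    have := mul_pos hc (sub_pos.2 hJ)
    rw [secondRHS]
    linarith
  · refine hGS.lt_integral_sub_integral_of_gainRate_nonpos hc (by positivity) hU hV1 hV2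
      (fun ε h0 hε => ?_) fun ε h0 hε => ?_
    · rw [← rateDiff_eq_gainRate]
      refine (le_max_right _ _).trans ((hmax _ _ _ ⟨h0.le, hV1.le, ?_, ?_⟩).trans hnonpos)
      · have := mul_pos hc (sub_pos.2 hε)
        positivity
      · rw [mul_add, hcn, ← hsum]
        ring
    · rw [← rateDiff_eq_gainRate]
      refine (le_max_right _ _).trans ((hmax _ _ _ ⟨h0.le, by linarith, hV2.le, ?_⟩).trans hnonpos)
      rw [← hsum]
      ring

theorem matrixY_self (PU PV1 PV2 : ℝ) (i : Fin n) :
    matrixY n PU PV1 PV2 i i = ((outerDiag (diagEntries n PV1 PV2) i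
      - outerDiag (diagEntries n (PU + PV1) PV2) i : ℝ) : ℂ) := by
  rw [matrixY, Matrix.sub_apply, expectedOuter_self, expectedOuter_self, Complex.ofReal_sub]

theorem trace_matrixY_mul (PU PV1 PV2 : ℝ) :
    (matrixY n PU PV1 PV2 *
        Matrix.diagonal fun i => (diagEntries n PV1 PV2 i : ℂ)).trace
      = ((PV1 * (outerDiag (diagEntries n PV1 PV2) 0
          - outerDiag (diagEntries n (PU + PV1) PV2) 0)
        + PV2 * (orthTrace n PV1 PV2 - orthTrace n (PU + PV1) PV2) : ℝ) : ℂ) := by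
  simp only [Matrix.trace, Matrix.diag_apply, Matrix.mul_diagonal, matrixY_self,
    ← Complex.ofReal_mul, ← Complex.ofReal_sum]
  congr 1
  rw [← Finset.add_sum_erase _ _ (Finset.mem_univ (0 : Fin n)), orthTrace, orthTrace,
    ← Finset.sum_sub_distrib, Finset.mul_sum]
  congr 1
  · rw [diagEntries, if_pos rfl, mul_comm]
  · refine Finset.sum_congr rfl fun i hi => ?_
    rw [mul_comm]
    congr 1
    exact if_neg (Finset.ne_of_mem_erase hi)

end Wiretap

theorem mainTheorem6 (n : ℕ) [NeZero n] (hn : 2 ≤ n) (h : EuclideanSpace ℂ (Fin n))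
    (PT PU PV1 PV2 : ℝ) (hopt : Wiretap.IsOptimal h PT PU PV1 PV2)
    (hV1 : 0 < PV1) (hV2 : 0 < PV2) (hne : PV2 ≠ PV1) (hne' : PV2 ≠ PU + PV1) :
    (0 < Wiretap.firstLHS n (‖h‖ ^ 2) PU PV1 PV2 →
      Wiretap.secondRHS (‖h‖ ^ 2) PU PV1 < Wiretap.secondLHS n PU PV1 PV2) ∧
    (Wiretap.firstLHS n (‖h‖ ^ 2) PU PV1 PV2 < 0 →
      Wiretap.secondLHS n PU PV1 PV2 < Wiretap.secondRHS (‖h‖ ^ 2) PU PV1) ∧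
    Wiretap.matrixY n PU PV1 PV2 0 0 = (Wiretap.secondLHS n PU PV1 PV2 : ℂ) ∧
    (Wiretap.matrixY n PU PV1 PV2 *
        Matrix.diagonal fun i => (Wiretap.diagEntries n PV1 PV2 i : ℂ)).trace -
      ((PV1 * Wiretap.secondRHS (‖h‖ ^ 2) PU PV1 : ℝ) : ℂ) =
        (Wiretap.firstLHS n (‖h‖ ^ 2) PU PV1 PV2 : ℂ) := by
  have hU : 0 ≤ PU := hopt.1.1
  have hη : 0 ≤ ‖h‖ ^ 2 := sq_nonneg _
  have hL2 := Wiretap.secondLHS_eq (n := n) hU hV1 hV2 hne hne'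
  have hL1 := Wiretap.firstLHS_eq (n := n) hη hU hV1 hV2 hne hne'
  refine ⟨fun hpos => ?_, fun hneg => ?_, ?_, ?_⟩
  · rcases hU.eq_or_lt with rfl | hU0
    -- Without signal power `D₁ = D₂` and `r = 0`, so `L₁ = 0`.
    · rw [hL1, hL2] at hpos
      simp [Wiretap.secondRHS] at hpos
    · rw [hL2]
      exact Wiretap.secondRHS_lt_of_isOptimal hn h hopt hU0 hV1 hV2
  · have hJ : Wiretap.orthTrace n (PU + PV1) PV2 ≤ Wiretap.orthTrace n PV1 PV2 := by
      rcases hU.eq_or_lt with rfl | hU0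
      · rw [zero_add]
      · have hGS := Wiretap.isGainPair_channelLaw hn
        rw [Wiretap.orthTrace_eq_integral (by positivity) hV2.le,
          Wiretap.orthTrace_eq_integral hV1.le hV2.le]
        exact (hGS.integral_div_lt_left hGS.integrable_right hGS.right_pos hV1.le hV2.le
          (lt_add_of_pos_left PV1 hU0)).le
    have := mul_nonneg hV2.le (sub_nonneg.2 hJ)
    refine lt_of_mul_lt_mul_left ?_ hV1.le
    linarith
  · rw [Wiretap.matrixY_self, hL2]
  · rw [Wiretap.trace_matrixY_mul, hL1, hL2, ← Complex.ofReal_sub]
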